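/- Theorem 1.2. Let $\mathbb{K}=\mathbb{R}$ or $\mathbb{K}=\mathbb{C}$, let $\omega_1$ be the first uncountable ordinal, and let $C([0,\omega_1])$ be the Banach space of continuous functions $[0,\omega_1]\to\mathbb{K}$ with the supremum norm, where $[0,\omega_1]$ is the set of ordinals $\le\omega_1$ with its order topology. By an operator we mean a bounded linear map from $C([0,\omega_1])$ to itself. By a theorem of Rudin, for every operator $T$ there are unique scalars $T_{\alpha,\beta}$ $(\alpha,\beta\in[0,\omega_1])$ such that, for every $\alpha\in[0,\omega_1]$, $$\sum_{\beta\in[0,\omega_1]}|T_{\alpha,\beta}|<\infty\quad\text{and}\quad (Tf)(\alpha)=\sum_{\beta\in[0,\omega_1]}T_{\alpha,\beta}\,f(\beta)\quad\text{for all } f\in C([0,\omega_1]).$$ The Loy–Willis ideal $\mathscr{M}$ is the set of all operators $T$ for which the final column $\alpha\mapsto T_{\alpha,\omega_1}$, $[0,\omega_1]\to\mathbb{K}$, is continuous at $\omega_1$. Then an operator $T$ belongs to $\mathscr{M}$ if and only if the identity operator $I$ on $C([0,\omega_1])$ does not factor through $T$, that is, if and only if there are no operators $R$ and $S$ on $C([0,\omega_1])$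 such that $I=STR$. -/

import Mathlib

open scoped Ordinal

namespace LoyWillis

/-- The ordinal interval `[0, ω₁]`. As a subtype of the ordinals its topology is the order
topology, since the interval is order-connected. -/
abbrev Interval : Type 1 := Set.Iic (ω₁ : Ordinal.{0})

/-- `[0, ω₁]` is compact, so that `C(Interval, 𝕜)` is a Banach space for the supremum norm. -/
instance instCompactSpaceInterval : CompactSpace Interval := by
  have h : IsCompact (Set.Icc (0 : Ordinal.{0}) ω₁) := isCompact_Icc
  rw [show Set.Icc (0 : Ordinal.{0}) ω₁ = Set.Iic ω₁ from
    Set.ext fun x => ⟨fun hx => hx.2, fun hx => ⟨zero_le, hx⟩⟩] at h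
  exact isCompact_iff_compactSpace.mp h

/-- The point `ω₁` of `[0, ω₁]`. -/
noncomputable def last : Interval := ⟨ω₁, Set.self_mem_Iic⟩

/-- `A` is the matrix of the operator `T` on `C([0, ω₁])`: each row of `A` is absolutely
summable, and `(T f)(α) = ∑ β, A α β * f β` for every `α` and every `f`.
By a theorem of Rudin, each bounded operator has exactly one such matrix. -/
structure IsMatrixOf {𝕜 : Type*} [RCLike 𝕜] (T : C(Interval, 𝕜) →L[𝕜] C(Interval, 𝕜))
    (A : Interval → Interval → 𝕜) : Prop where
  summable_row : ∀ α : Interval, Summable fun β => ‖A α β‖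
  hasSum_row : ∀ (f : C(Interval, 𝕜)) (α : Interval), HasSum (fun β => A α β * f β) (T f α)

/-- The Loy–Willis ideal: the set of those bounded operators on `C([0, ω₁])` whose matrix has a
final column `α ↦ A α ω₁` that is continuous at `ω₁`. -/
def loyWillisIdeal (𝕜 : Type*) [RCLike 𝕜] : Set (C(Interval, 𝕜) →L[𝕜] C(Interval, 𝕜)) :=
  {T | ∃ A : Interval → Interval → 𝕜, IsMatrixOf T A ∧ ContinuousAt (fun α => A α last) last}

/-- The identity operator factors through `T`: there are bounded operators `R` and `S` with
`I = S T R`. -/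
def IdentityFactorsThrough {𝕜 : Type*} [RCLike 𝕜]
    (T : C(Interval, 𝕜) →L[𝕜] C(Interval, 𝕜)) : Prop :=
  ∃ R S : C(Interval, 𝕜) →L[𝕜] C(Interval, 𝕜),
    ContinuousLinearMap.id 𝕜 C(Interval, 𝕜) = S.comp (T.comp R)

end LoyWillis

namespace LoyWillis

open Set Filter Topology

/-! Every countable subset of `[0, ω₁)` is bounded below `ω₁`. Rows of a matrix have countable
support, so `T (1 - chi 𝕜 β) α` equals the entry `A α last` once `β` is large. The final column is
therefore bounded and continuous on `[0, ω₁)`, hence eventually constant, and it is `g + c · 1_{ω₁}`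
with `g` continuous (`exists_column_eq`). Membership in the ideal means `c = 0`. If `c = 0` and `I =
S T R`, then `T R (1 - chi 𝕜 β)` stabilises pointwise to a continuous function. Operators respect
this convergence (`eventually_apply_eq`), so applying `S` makes the indicator of `{ω₁}` continuous,
which is absurd. If `c ≠ 0`, a closing-off argument (`exists_apply_eq_mul`) gives a closed cofinal
set on which `T f = c f` for all `f` vanishing at `ω₁` and on some `[0, γ]`. This set contains a
retract of `[0, ω₁]` homeomorphic to `[0, ω₁]`, through which the identity factors. -/

/-! ### The topology of `[0, ω₁]` near its last point -/

theorem lt_last_iff_ne {α : Interval} : α < last ↔ α ≠ last :=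
  ⟨ne_of_lt, fun h => lt_of_le_of_ne α.2 h⟩

theorem isClopen_Iic (β : Interval) : IsClopen (Iic β) := by
  refine ⟨isClosed_Iic, ?_⟩
  have : Iic β = Subtype.val ⁻¹' Iio (Order.succ β.1) := by
    ext x; simp [← Subtype.coe_le_coe]
  rw [this]
  exact isOpen_Iio.preimage continuous_subtype_val

theorem countable_Iio_of_lt_omega_one {o : Ordinal.{0}} (ho : o < ω₁) : (Iio o).Countable := by
  have h := Cardinal.lt_ord.1 (ho.trans_eq (Cardinal.ord_aleph 1).symm)
  rw [← Cardinal.le_aleph0_iff_set_countable, Cardinal.mk_Iio_ordinal]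
  exact Cardinal.lift_le_aleph0.2 (by rwa [← Order.lt_succ_iff, Cardinal.succ_aleph0])

theorem countable_Iic_of_lt_last {α : Interval} (hα : α < last) : (Iic α).Countable := by
  have h := countable_Iio_of_lt_omega_one ((Cardinal.isSuccLimit_omega 1).succ_lt hα)
  exact ((h.preimage Subtype.val_injective).mono fun x hx => by
    simpa [← Subtype.coe_le_coe] using hx)

theorem exists_lt_last_forall_lt {ι : Type*} [Countable ι] (f : ι → Interval)
    (hf : ∀ i, f i < last) : ∃ β < last, ∀ i, f i < β := by
  have h : ⨆ i, Order.succ (f i).1 < ω₁ :=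
    Ordinal.iSup_lt_omega_one fun i => (Cardinal.isSuccLimit_omega 1).succ_lt (hf i)
  refine ⟨⟨_, h.le⟩, h, fun i => ?_⟩
  have hb : BddAbove (range fun i => Order.succ (f i).1) :=
    ⟨ω₁, by rintro _ ⟨i, rfl⟩; exact ((Cardinal.isSuccLimit_omega 1).succ_lt (hf i)).le⟩
  have h' : (f i).1 < ⨆ i, Order.succ (f i).1 :=
    (Order.lt_succ (f i).1).trans_le (le_ciSup hb i)
  exact h'

theorem exists_lt_last_of_lt_last {α : Interval} (hα : α < last) : ∃ β < last, α < β := by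
  obtain ⟨β, hβ, h⟩ := exists_lt_last_forall_lt (fun _ : Unit => α) fun _ => hα
  exact ⟨β, hβ, h ()⟩

theorem exists_lt_last : ∃ β : Interval, β < last := by
  obtain ⟨β, hβ, -⟩ := exists_lt_last_forall_lt (fun i : Empty => i.elim) fun i => i.elim
  exact ⟨β, hβ⟩

theorem eventually_nhdsLT_last {p : Interval → Prop} :
    (∀ᶠ β in 𝓝[<] last, p β) ↔ ∃ β < last, ∀ γ, β < γ → γ < last → p γ := by
  rw [(nhdsLT_basis_of_exists_lt exists_lt_last).eventually_iff]
  simp [and_imp]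

theorem eventually_gt_nhdsLT_last {α : Interval} (hα : α < last) : ∀ᶠ β in 𝓝[<] last, α < β :=
  eventually_nhdsLT_last.2 ⟨α, hα, fun _ h _ => h⟩

theorem eventually_lt_last : ∀ᶠ β in 𝓝[<] last, β < last := eventually_mem_nhdsWithin

instance instNeBotNhdsLTLast : (𝓝[<] last).NeBot := by
  refine ⟨fun h => ?_⟩
  obtain ⟨β, hβ, h'⟩ := eventually_nhdsLT_last.1 (show ∀ᶠ β in 𝓝[<] last, False by simp [h])
  obtain ⟨γ, hγ, hβγ⟩ := exists_lt_last_of_lt_last hβ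
  exact h' γ hβγ hγ

instance instCountableInterFilterNhdsLTLast : CountableInterFilter (𝓝[<] last) := by
  refine ⟨fun S hS h => ?_⟩
  have : Countable S := hS
  choose f hf hf' using fun s : S => eventually_nhdsLT_last.1 (h s s.2)
  obtain ⟨β, hβ, hfβ⟩ := exists_lt_last_forall_lt f hf
  refine eventually_nhdsLT_last.2 ⟨β, hβ, fun γ h1 h2 s hs => ?_⟩
  exact hf' ⟨s, hs⟩ γ ((hfβ _).trans h1) h2

theorem nhdsNE_last : 𝓝[≠] last = 𝓝[<] last := by
  congr 1; ext x; exact lt_last_iff_ne.symm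

/-- Closing-off: iterate a map `p` whose value at `α` serves every one of the countably many `α' ≤
α`; the supremum `δ` of the iterates works. -/
theorem exists_closed_under {Q : Interval → Interval → Prop}
    (hQ : ∀ α < last, ∀ᶠ β in 𝓝[<] last, Q α β) {δ₀ : Interval} (hδ₀ : δ₀ < last) :
    ∃ δ < last, δ₀ < δ ∧ ∀ α < δ, ∃ β < δ, α < β ∧ Q α β := by
  have hstep : ∀ α : Iio last, ∃ β : Iio last, α < β ∧ ∀ α' ≤ α.1, Q α' β := by
    intro α
    have h := (eventually_countable_ball (countable_Iic_of_lt_last α.2)).2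
      fun α' (h : α' ≤ α.1) => hQ α' (h.trans_lt α.2)
    obtain ⟨β, h1, h2, h3⟩ :=
      ((eventually_gt_nhdsLT_last α.2).and (eventually_lt_last.and h)).exists
    exact ⟨⟨β, h2⟩, h1, h3⟩
  choose p hp hp' using hstep
  let u : ℕ → Iio last := fun n => p^[n] ⟨δ₀, hδ₀⟩
  have hu : ∀ n, u (n + 1) = p (u n) := fun n => Function.iterate_succ_apply' _ _ _
  have hlt : ∀ n, (u n).1 < (u (n + 1)).1 := fun n => by rw [hu]; exact hp _
  have hne : {δ : Interval | ∀ n, (u n).1 < δ}.Nonempty := ⟨last, fun n => (u n).2⟩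
  obtain ⟨ε, hε, hε'⟩ := exists_lt_last_forall_lt (fun n => (u n).1) fun n => (u n).2
  let δ := wellFounded_lt.min _ hne
  have hδ : ∀ n, (u n).1 < δ := wellFounded_lt.min_mem _ hne
  have hmin : ∀ α < δ, ∃ n, α ≤ (u n).1 := fun α hα => by
    by_contra! h
    exact wellFounded_lt.not_lt_min (s := {δ : Interval | ∀ n, (u n).1 < δ}) h hα
  refine ⟨δ, (not_lt.1
    (wellFounded_lt.not_lt_min (s := {δ : Interval | ∀ n, (u n).1 < δ}) hε')).trans_lt hε,
    hδ 0, fun α hα => ?_⟩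
  obtain ⟨n, hn⟩ := hmin α hα
  refine ⟨u (n + 1), hδ _, hn.trans_lt (hlt n), ?_⟩
  rw [hu]
  exact hp' _ _ hn

theorem mem_closure_of_forall_lt {δ α₀ : Interval} (hα₀ : α₀ < δ) {s : Set Interval}
    (h : ∀ α < δ, ∃ β < δ, α < β ∧ β ∈ s) : δ ∈ closure (s ∩ Iio δ) := by
  rw [mem_closure_iff_nhds]
  intro t ht
  obtain ⟨l, hl, hlt⟩ := exists_Ioc_subset_of_mem_nhds ht ⟨α₀, hα₀⟩
  obtain ⟨β, hβ, hlβ, hs⟩ := h l hl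
  exact ⟨β, hlt ⟨hlβ, hβ.le⟩, hs, hβ⟩

theorem exists_mem_closure_inter_closure {s t : Set Interval} (hs : ∃ᶠ β in 𝓝[<] last, β ∈ s)
    (ht : ∃ᶠ β in 𝓝[<] last, β ∈ t) : ∃ δ < last, δ ∈ closure s ∧ δ ∈ closure t := by
  have key : ∀ s : Set Interval, (∃ᶠ β in 𝓝[<] last, β ∈ s) → ∀ α < last,
      ∀ᶠ β in 𝓝[<] last, ∃ x ≤ β, α < x ∧ x ∈ s := by
    intro s hs α hα
    obtain ⟨x, hxs, hαx, hx⟩ :=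
      (hs.and_eventually ((eventually_gt_nhdsLT_last hα).and eventually_lt_last)).exists
    exact (eventually_gt_nhdsLT_last hx).mono fun β h => ⟨x, h.le, hαx, hxs⟩
  obtain ⟨ε, hε⟩ := exists_lt_last
  obtain ⟨δ, hδ, hεδ, h⟩ :=
    exists_closed_under (fun α hα => (key s hs α hα).and (key t ht α hα)) hε
  refine ⟨δ, hδ, closure_mono inter_subset_left (mem_closure_of_forall_lt hεδ fun α hα => ?_),
    closure_mono inter_subset_left (mem_closure_of_forall_lt hεδ fun α hα => ?_)⟩
  · obtain ⟨β, hβ, -, ⟨x, hx, hαx, hxs⟩, -⟩ := h α hα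
    exact ⟨x, hx.trans_lt hβ, hαx, hxs⟩
  · obtain ⟨β, hβ, -, -, ⟨x, hx, hαx, hxs⟩⟩ := h α hα
    exact ⟨x, hx.trans_lt hβ, hαx, hxs⟩

/-! ### Eventual constancy -/

variable {𝕜 : Type*} [RCLike 𝕜]

theorem eventually_eq_of_tendsto_nhdsLT_last {k : Interval → 𝕜} {a : 𝕜}
    (h : Tendsto k (𝓝[<] last) (𝓝 a)) : ∀ᶠ α in 𝓝[<] last, k α = a := by
  have h' : ∀ᶠ α in 𝓝[<] last, ∀ n : ℕ, dist (k α) a < 1 / (n + 1) :=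
    eventually_countable_forall.2 fun n => Metric.tendsto_nhds.1 h _ Nat.one_div_pos_of_nat
  filter_upwards [h'] with α hα
  by_contra hne
  obtain ⟨n, hn⟩ := exists_nat_one_div_lt (dist_pos.2 hne)
  exact (hα n).not_gt hn

theorem eventually_eq_last (f : C(Interval, 𝕜)) : ∀ᶠ α in 𝓝[<] last, f α = f last :=
  eventually_eq_of_tendsto_nhdsLT_last f.continuous.continuousWithinAt

/-- A bounded continuous function on `[0, ω₁)` is eventually constant. -/
theorem exists_eventually_eq_of_continuousAt {k : Interval → 𝕜} {C : ℝ} (hC : ∀ α, ‖k α‖ ≤ C)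
    (hk : ∀ α < last, ContinuousAt k α) : ∃ a, ∀ᶠ α in 𝓝[<] last, k α = a := by
  obtain ⟨a, -, ha⟩ := (isCompact_closedBall (0 : 𝕜) C).exists_mapClusterPt
    (f := 𝓝[<] last) (u := k) (by
      exact tendsto_principal.2 <| Eventually.of_forall fun α => by simpa using hC α)
  refine ⟨a, eventually_eq_of_tendsto_nhdsLT_last (Metric.tendsto_nhds.2 fun ε hε => ?_)⟩
  -- Otherwise the points near the cluster value and those far from it are both cofinal, so their
  -- closures meet below `ω₁`, against continuity there.
  by_contra hfar
  have hnear : ∃ᶠ α in 𝓝[<] last, α ∈ {α | dist (k α) a < ε / 2} :=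
    ha.frequently (Metric.ball_mem_nhds a (half_pos hε))
  obtain ⟨δ, hδ, h1, h2⟩ := exists_mem_closure_inter_closure hnear
    (show ∃ᶠ α in 𝓝[<] last, α ∈ {α | ε ≤ dist (k α) a} by simpa using hfar)
  have hd : Tendsto (fun α => dist (k α) a) (𝓝 δ) (𝓝 (dist (k δ) a)) :=
    (hk δ hδ).dist tendsto_const_nhds
  have h3 : dist (k δ) a ≤ ε / 2 := by
    refine le_of_tendsto_of_frequently hd ?_
    exact (mem_closure_iff_frequently.1 h1).mono fun α (h : _ < _) => h.le
  have h4 : ε ≤ dist (k δ) a :=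
    ge_of_tendsto_of_frequently hd (mem_closure_iff_frequently.1 h2)
  linarith

/-! ### Indicators of initial segments -/

variable (𝕜) in
/-- The indicator function of `[0, β]`. -/
noncomputable def chi (β : Interval) : C(Interval, 𝕜) :=
  ⟨(Iic β).indicator 1, (isClopen_Iic β).continuous_indicator continuous_one⟩

theorem chi_of_le {α β : Interval} (h : α ≤ β) : chi 𝕜 β α = 1 :=
  indicator_of_mem (s := Iic β) h 1

theorem chi_of_lt {α β : Interval} (h : β < α) : chi 𝕜 β α = 0 :=
  indicator_of_notMem (s := Iic β) (not_le.2 h) 1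

theorem chi_last : chi 𝕜 last = 1 := by
  ext α; exact chi_of_le α.2

theorem exists_norm_sub_le (f : C(Interval, 𝕜)) {α₀ β : Interval} (h : α₀ < β) {ε : ℝ}
    (hε : 0 < ε) : ∃ η < β, ∀ x, η < x → x ≤ β → ‖f x - f β‖ ≤ ε := by
  have := f.continuous.continuousAt.preimage_mem_nhds (Metric.closedBall_mem_nhds (f β) hε)
  obtain ⟨η, hη, h'⟩ := exists_Ioc_subset_of_mem_nhds this ⟨α₀, h⟩
  exact ⟨η, hη, fun x h1 h2 => by simpa [dist_eq_norm] using h' ⟨h1, h2⟩⟩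

theorem norm_mul_chi_sub_chi_le {f : C(Interval, 𝕜)} {η β : Interval} {C : ℝ}
    (hC : 0 ≤ C) (h : ∀ x, η < x → x ≤ β → ‖f x‖ ≤ C) (hηβ : η ≤ β) :
    ‖f * (chi 𝕜 β - chi 𝕜 η)‖ ≤ C := by
  refine (ContinuousMap.norm_le _ hC).2 fun x => ?_
  rcases le_or_gt x η with h1 | h1
  · simpa [chi_of_le h1, chi_of_le (h1.trans hηβ)] using hC
  rcases le_or_gt x β with h2 | h2
  · simpa [chi_of_le h2, chi_of_lt h1] using h x h1 h2
  · simpa [chi_of_lt h1, chi_of_lt h2] using hC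

theorem mul_chi_of_not_exists_lt (f : C(Interval, 𝕜)) {β : Interval} (h : ¬ ∃ η, η < β) :
    f * chi 𝕜 β = f β • chi 𝕜 β := by
  ext x
  rcases lt_trichotomy x β with h1 | rfl | h1
  · exact (h ⟨x, h1⟩).elim
  · simp
  · simp [chi_of_lt h1]

/-- Bounded functionals on `C([0, ω₁])` are determined by their values on the indicator functions
of initial segments. -/
theorem eq_zero_of_apply_chi_eq_zero {ψ : C(Interval, 𝕜) →L[𝕜] 𝕜} (h : ∀ β, ψ (chi 𝕜 β) = 0) :
    ψ = 0 := by
  have key : ∀ β, ∀ f, ψ (f * chi 𝕜 β) = 0 := by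
    intro β
    refine wellFounded_lt.induction (C := fun β => ∀ f, ψ (f * chi 𝕜 β) = 0) β fun β ih f => ?_
    by_cases hβ : ∃ η, η < β
    · obtain ⟨α₀, hα₀⟩ := hβ
      have hb : ∀ ε > 0, ‖ψ (f * chi 𝕜 β)‖ ≤ ‖ψ‖ * ε := by
        intro ε hε
        obtain ⟨η, hη, hf⟩ := exists_norm_sub_le f hα₀ hε
        have h1 : f * chi 𝕜 β = f * chi 𝕜 η + f β • (chi 𝕜 β - chi 𝕜 η) +
            (f - algebraMap 𝕜 C(Interval, 𝕜) (f β)) * (chi 𝕜 β - chi 𝕜 η) := by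
          rw [Algebra.smul_def]; ring
        rw [h1, map_add, map_add, ih η hη, map_smul, map_sub, h, h]
        simp only [sub_self, smul_zero, zero_add]
        refine ψ.le_opNorm_of_le (norm_mul_chi_sub_chi_le hε.le ?_ hη.le)
        simpa using hf
      refine norm_le_zero_iff.1 (le_of_forall_gt_imp_ge_of_dense fun δ hδ => ?_)
      refine (hb (δ / (‖ψ‖ + 1)) (by positivity)).trans ?_
      rw [mul_div_assoc', div_le_iff₀ (by positivity)]
      nlinarith [norm_nonneg ψ]
    · rw [mul_chi_of_not_exists_lt f hβ, map_smul, h, smul_zero]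
  ext f
  simpa [chi_last] using key last f

/-! ### Rudin's theorem -/

theorem summable_lp_one_mul (a : lp (fun _ : Interval => 𝕜) 1) (f : C(Interval, 𝕜)) :
    Summable fun β => ‖a β * f β‖ := by
  have ha : Summable fun β => ‖a β‖ := by
    simpa using (lp.hasSum_norm (by simp) a).summable
  refine (ha.mul_right ‖f‖).of_nonneg_of_le (fun _ => norm_nonneg _) fun β => ?_
  rw [norm_mul]
  gcongr
  exact f.norm_coe_le_norm β

theorem hasSum_norm_lp_one (a : lp (fun _ : Interval => 𝕜) 1) : HasSum (fun β => ‖a β‖) ‖a‖ := by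
  simpa using lp.hasSum_norm (by simp) a

theorem norm_tsum_lp_one_mul_le (a : lp (fun _ : Interval => 𝕜) 1) (f : C(Interval, 𝕜)) :
    ‖∑' β, a β * f β‖ ≤ ‖a‖ * ‖f‖ := by
  refine (norm_tsum_le_tsum_norm (summable_lp_one_mul a f)).trans ?_
  rw [← (hasSum_norm_lp_one a).tsum_eq, ← tsum_mul_right]
  refine (summable_lp_one_mul a f).tsum_le_tsum (fun β => ?_)
    ((hasSum_norm_lp_one a).summable.mul_right _)
  rw [norm_mul]
  gcongr
  exact f.norm_coe_le_norm β

/-- The functional on `C([0, ω₁])` given by an absolutely summable family of point masses. -/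
noncomputable def discreteFunctional :
    lp (fun _ : Interval => 𝕜) 1 →ₗ[𝕜] (C(Interval, 𝕜) →L[𝕜] 𝕜) where
  toFun a := LinearMap.mkContinuous
    { toFun := fun f => ∑' β, a β * f β
      map_add' := fun f g => by
        rw [← (summable_lp_one_mul a f).of_norm.tsum_add (summable_lp_one_mul a g).of_norm]
        simp [mul_add]
      map_smul' := fun c f => by
        simp only [RingHom.id_apply, smul_eq_mul]
        rw [← tsum_mul_left]
        simp [mul_left_comm] } ‖a‖ (norm_tsum_lp_one_mul_le a)
  map_add' a b := by
    ext f
    simp only [LinearMap.mkContinuous_apply, LinearMap.coe_mk, AddHom.coe_mk,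
      add_apply]
    rw [← (summable_lp_one_mul a f).of_norm.tsum_add (summable_lp_one_mul b f).of_norm]
    simp [add_mul]
  map_smul' c a := by
    ext f
    simp [← tsum_mul_left, mul_assoc]

theorem discreteFunctional_apply (a : lp (fun _ : Interval => 𝕜) 1) (f : C(Interval, 𝕜)) :
    discreteFunctional a f = ∑' β, a β * f β := rfl

theorem norm_discreteFunctional_le (a : lp (fun _ : Interval => 𝕜) 1) :
    ‖discreteFunctional a‖ ≤ ‖a‖ :=
  ContinuousLinearMap.opNorm_le_bound _ (norm_nonneg _) (norm_tsum_lp_one_mul_le a)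

theorem exists_norm_le_one_mul_eq_norm (a : Interval → 𝕜) (s : Finset Interval) :
    ∃ f : C(Interval, 𝕜), (∀ x, ‖f x‖ ≤ 1) ∧ ∀ β ∈ s, a β * f β = ‖a β‖ := by
  choose c hc hc' using fun β => RCLike.exists_norm_eq_mul_self (a β)
  obtain ⟨f, hf, hf'⟩ := ContinuousMap.exists_forall_mem_restrict_eq
    (s := (s : Set Interval)) s.finite_toSet.isClosed
    (f := ⟨fun β => c β, continuous_of_discreteTopology⟩) (t := Metric.closedBall (0 : 𝕜) 1)
    (fun β => by simp [hc])
  refine ⟨f, fun x => by simpa using hf x, fun β hβ => ?_⟩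
  have := DFunLike.congr_fun hf' ⟨β, hβ⟩
  simp only [ContinuousMap.restrict_apply, ContinuousMap.coe_mk] at this
  rw [this, hc', mul_comm]

theorem norm_discreteFunctional (a : lp (fun _ : Interval => 𝕜) 1) :
    ‖discreteFunctional a‖ = ‖a‖ := by
  refine (norm_discreteFunctional_le a).antisymm ?_
  have hs := hasSum_norm_lp_one a
  -- Testing on `f` with `a β * f β = ‖a β‖` on `s` loses at most the tail `‖a‖ - ∑ β ∈ s, ‖a β‖`,
  -- which gives the factor 2.
  have key : ∀ s : Finset Interval, 2 * ∑ β ∈ s, ‖a β‖ ≤ ‖discreteFunctional a‖ + ‖a‖ := by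
    intro s
    obtain ⟨f, hf, hfs⟩ := exists_norm_le_one_mul_eq_norm a s
    have h1 := (summable_lp_one_mul a f).of_norm.sum_add_tsum_compl (s := s)
    have h2 := hs.summable.sum_add_tsum_compl (s := s)
    rw [hs.tsum_eq] at h2
    rw [← discreteFunctional_apply, Finset.sum_congr rfl hfs] at h1
    have h3 : ‖discreteFunctional a f‖ ≤ ‖discreteFunctional a‖ := by
      simpa using (discreteFunctional a).le_opNorm_of_le
        ((ContinuousMap.norm_le _ zero_le_one).2 hf)
    have h4 : ‖∑' β : ↑(s : Set Interval)ᶜ, a β * f β‖ ≤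
        ∑' β : ↑(s : Set Interval)ᶜ, ‖a β‖ := by
      refine (norm_tsum_le_tsum_norm ((summable_lp_one_mul a f).subtype _)).trans ?_
      refine ((summable_lp_one_mul a f).subtype _).tsum_le_tsum (fun β => ?_) (hs.summable.subtype _)
      simpa using mul_le_mul_of_nonneg_left (hf β) (norm_nonneg (a β))
    have h5 : ‖((∑ β ∈ s, ‖a β‖ : ℝ) : 𝕜)‖ = ∑ β ∈ s, ‖a β‖ := by
      rw [RCLike.norm_ofReal, abs_of_nonneg (Finset.sum_nonneg fun _ _ => norm_nonneg _)]
    have h6 := norm_sub_le (discreteFunctional a f) (∑' β : ↑(s : Set Interval)ᶜ, a β * f β)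
    rw [← h1, add_sub_cancel_right, ← RCLike.ofReal_sum, h5, RCLike.ofReal_sum, h1] at h6
    linarith
  have h := le_of_tendsto' (Tendsto.const_mul 2 hs) key
  linarith

theorem isClosed_range_discreteFunctional :
    IsClosed (LinearMap.range (discreteFunctional (𝕜 := 𝕜)) : Set (C(Interval, 𝕜) →L[𝕜] 𝕜)) := by
  rw [LinearMap.coe_range]
  exact (Isometry.isClosedEmbedding (α := lp (fun _ : Interval => 𝕜) 1)
    (γ := C(Interval, 𝕜) →L[𝕜] 𝕜) (AddMonoidHomClass.isometry_of_norm discreteFunctional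
      norm_discreteFunctional)).isClosed_range

variable (𝕜) in
/-- Evaluation at a point of `[0, ω₁]`. -/
noncomputable abbrev eval (β : Interval) : C(Interval, 𝕜) →L[𝕜] 𝕜 :=
  ContinuousMap.evalCLM 𝕜 β

theorem eval_mem_range_discreteFunctional (β : Interval) :
    eval 𝕜 β ∈ LinearMap.range (discreteFunctional (𝕜 := 𝕜)) := by
  classical
  refine ⟨lp.single 1 β 1, ?_⟩
  ext f
  rw [discreteFunctional_apply, tsum_eq_single β]
  · simp
  · intro η hη
    simp [hη]

/-- The restriction of a functional to functions supported in `[0, β]`. -/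
noncomputable def truncate (φ : C(Interval, 𝕜) →L[𝕜] 𝕜) (β : Interval) : C(Interval, 𝕜) →L[𝕜] 𝕜 :=
  φ.comp (ContinuousLinearMap.mul 𝕜 C(Interval, 𝕜) (chi 𝕜 β))

theorem truncate_apply (φ : C(Interval, 𝕜) →L[𝕜] 𝕜) (β : Interval) (f : C(Interval, 𝕜)) :
    truncate φ β f = φ (f * chi 𝕜 β) := by
  simp [truncate, mul_comm]

theorem norm_add_norm_le_of_forall_exists {E : Type*} [NormedAddCommGroup E] [NormedSpace 𝕜 E]
    (φ ψ θ : E →L[𝕜] 𝕜)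
    (h : ∀ f g, ‖f‖ ≤ 1 → ‖g‖ ≤ 1 → ∃ k, ‖k‖ ≤ 1 ∧ θ k = φ f + ψ g) : ‖φ‖ + ‖ψ‖ ≤ ‖θ‖ := by
  have aux : ∀ (φ : E →L[𝕜] 𝕜) (ε : ℝ),
      0 < ε → ∃ f, ‖f‖ ≤ 1 ∧ ∃ r : ℝ, φ f = r ∧ ‖φ‖ - ε < r := by
    intro φ ε hε
    obtain ⟨f, hf, hf'⟩ := φ.exists_lt_apply_of_lt_opNorm (sub_lt_self ‖φ‖ hε)
    obtain ⟨c, hc, hc'⟩ := RCLike.exists_norm_eq_mul_self (φ f)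
    exact ⟨c • f, by simpa [norm_smul, hc] using hf.le, ‖φ f‖, by simp [hc'], hf'⟩
  refine le_of_forall_pos_le_add fun ε hε => ?_
  obtain ⟨f, hf, r, hr, hr'⟩ := aux φ (ε / 2) (half_pos hε)
  obtain ⟨g, hg, t, ht, ht'⟩ := aux ψ (ε / 2) (half_pos hε)
  obtain ⟨k, hk, hk'⟩ := h f g hf hg
  have h1 : ‖θ k‖ ≤ ‖θ‖ := by simpa using θ.le_opNorm_of_le hk
  rw [hk', hr, ht, ← RCLike.ofReal_add, RCLike.norm_ofReal] at h1
  linarith [le_abs_self (r + t)]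

/-- Test functions for the two parts can be glued along the clopen sets `[0, η]` and `(η, β]`. -/
theorem norm_truncate_add_norm_sub_le (φ : C(Interval, 𝕜) →L[𝕜] 𝕜) {η β : Interval} (h : η ≤ β) :
    ‖truncate φ η‖ + ‖truncate φ β - truncate φ η‖ ≤ ‖truncate φ β‖ := by
  refine norm_add_norm_le_of_forall_exists _ _ _ fun f g hf hg => ?_
  refine ⟨f * chi 𝕜 η + g * (chi 𝕜 β - chi 𝕜 η), ?_, ?_⟩
  · refine (ContinuousMap.norm_le _ zero_le_one).2 fun x => ?_
    have hfx := (f.norm_coe_le_norm x).trans hf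
    have hgx := (g.norm_coe_le_norm x).trans hg
    rcases le_or_gt x η with h1 | h1
    · simpa [chi_of_le h1, chi_of_le (h1.trans h)]
    rcases le_or_gt x β with h2 | h2
    · simpa [chi_of_le h2, chi_of_lt h1]
    · simp [chi_of_lt h1, chi_of_lt h2]
  · simp only [truncate_apply, sub_apply, ← map_sub, ← map_add]
    congr 1
    ext x
    rcases le_or_gt x η with h1 | h1
    · simp [chi_of_le h1, chi_of_le (h1.trans h)]
    · rcases le_or_gt x β with h2 | h2
      · simp [chi_of_lt h1, chi_of_le h2]
      · simp [chi_of_lt h1, chi_of_lt h2]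

/-- Transfinite induction. The norms of the truncations increase and are bounded, so just below `β`
almost no variation is left; up to a small error only a point mass at `β` must be added, and the
range is closed. -/
theorem truncate_mem_range_discreteFunctional (φ : C(Interval, 𝕜) →L[𝕜] 𝕜) (β : Interval) :
    truncate φ β ∈ LinearMap.range (discreteFunctional (𝕜 := 𝕜)) := by
  refine wellFounded_lt.induction
    (C := fun β => truncate φ β ∈ LinearMap.range (discreteFunctional (𝕜 := 𝕜))) β fun β ih => ?_
  by_cases hβ : ∃ η, η < β
  · rw [← SetLike.mem_coe, ← isClosed_range_discreteFunctional.closure_eq, Metric.mem_closure_iff]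
    intro ε hε
    let S := (fun η => ‖truncate φ η‖) '' Iio β
    have hS : BddAbove S := by
      refine ⟨‖truncate φ β‖, ?_⟩
      rintro _ ⟨η, hη, rfl⟩
      linarith [norm_truncate_add_norm_sub_le φ (le_of_lt hη),
        norm_nonneg (truncate φ β - truncate φ η)]
    have hne : S.Nonempty := Set.Nonempty.image _ hβ
    obtain ⟨_, ⟨η, hη, rfl⟩, hηS⟩ :=
      exists_lt_of_lt_csSup hne (sub_lt_self (sSup S) (half_pos (half_pos hε)))
    have hη' : ∀ η' < β, η ≤ η' → ‖truncate φ η' - truncate φ η‖ ≤ ε / 4 := by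
      intro η' h1 h2
      have h3 : ‖truncate φ η'‖ ≤ sSup S := le_csSup hS (mem_image_of_mem _ h1)
      linarith [norm_truncate_add_norm_sub_le φ h2]
    refine ⟨truncate φ η + (truncate φ β 1 - truncate φ η 1) • eval 𝕜 β,
      add_mem (ih η hη) (Submodule.smul_mem _ _ (eval_mem_range_discreteFunctional β)), ?_⟩
    rw [dist_eq_norm]
    refine (ContinuousLinearMap.opNorm_le_bound _ (half_pos hε).le fun f => ?_).trans_lt
      (half_lt_self hε)
    let g : C(Interval, 𝕜) := f - f β • 1
    have hg : ‖g‖ ≤ 2 * ‖f‖ := by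
      refine (ContinuousMap.norm_le _ (by positivity)).2 fun x => ?_
      have := (norm_sub_le (f x) (f β)).trans
        (add_le_add (f.norm_coe_le_norm x) (f.norm_coe_le_norm β))
      simpa [g, two_mul] using this
    have h1 : (truncate φ β - (truncate φ η + (truncate φ β 1 - truncate φ η 1) • eval 𝕜 β)) f
        = (truncate φ β - truncate φ η) g := by
      simp [g]
      ring
    rw [h1]
    have hb : ∀ δ > 0, ‖(truncate φ β - truncate φ η) g‖ ≤ ε / 2 * ‖f‖ + ‖φ‖ * δ := by
      intro δ hδ
      obtain ⟨ζ, hζ, hfζ⟩ := exists_norm_sub_le f hη hδ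
      have hm : max η ζ < β := max_lt hη hζ
      have h2 : (truncate φ β - truncate φ η) g =
          (truncate φ (max η ζ) - truncate φ η) g + φ (g * (chi 𝕜 β - chi 𝕜 (max η ζ))) := by
        simp only [sub_apply, truncate_apply, mul_sub, map_sub]
        ring
      rw [h2]
      refine (norm_add_le _ _).trans (add_le_add ?_ (φ.le_opNorm_of_le ?_))
      · refine ((truncate φ (max η ζ) - truncate φ η).le_opNorm_of_le hg).trans ?_
        nlinarith [hη' _ hm (le_max_left _ _), norm_nonneg f]
      · refine norm_mul_chi_sub_chi_le hδ.le (fun x hx hx' => ?_) hm.le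
        simpa [g] using hfζ x ((le_max_right _ _).trans_lt hx) hx'
    refine le_of_forall_pos_le_add fun δ hδ => (hb (δ / (‖φ‖ + 1)) (by positivity)).trans ?_
    rw [mul_div_assoc']
    gcongr
    rw [div_le_iff₀ (by positivity)]
    nlinarith [norm_nonneg φ]
  · have : truncate φ β = φ (chi 𝕜 β) • eval 𝕜 β := by
      ext f
      simp [truncate_apply, mul_chi_of_not_exists_lt f hβ, mul_comm]
    rw [this]
    exact Submodule.smul_mem _ _ (eval_mem_range_discreteFunctional β)

/-- **Rudin's theorem**: a bounded functional on `C([0, ω₁])` is an absolutely summable combination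
of point evaluations. -/
theorem exists_summable_hasSum (φ : C(Interval, 𝕜) →L[𝕜] 𝕜) :
    ∃ a : Interval → 𝕜, (Summable fun β => ‖a β‖) ∧ ∀ f, HasSum (fun β => a β * f β) (φ f) := by
  obtain ⟨a, ha⟩ := truncate_mem_range_discreteFunctional φ last
  refine ⟨a, (hasSum_norm_lp_one a).summable, fun f => ?_⟩
  have h : φ f = ∑' β, a β * f β := by
    rw [← discreteFunctional_apply, ha, truncate_apply, chi_last, mul_one]
  rw [h]
  exact (summable_lp_one_mul a f).of_norm.hasSum

theorem exists_isMatrixOf (T : C(Interval, 𝕜) →L[𝕜] C(Interval, 𝕜)) : ∃ A, IsMatrixOf T A := by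
  choose A hA hA' using fun α => exists_summable_hasSum ((eval 𝕜 α).comp T)
  exact ⟨A, hA, fun f α => hA' α f⟩

/-! ### The final column -/

theorem one_sub_chi_last {β : Interval} (hβ : β < last) : (1 - chi 𝕜 β) last = 1 := by
  simp [chi_of_lt hβ]

theorem eventually_one_sub_chi_apply (α : Interval) :
    ∀ᶠ β in 𝓝[<] last, (1 - chi 𝕜 β) α = if α = last then 1 else 0 := by
  split_ifs with h
  · subst h
    exact eventually_lt_last.mono fun β hβ => one_sub_chi_last hβ
  · exact (eventually_gt_nhdsLT_last (lt_last_iff_ne.2 h)).mono fun β hβ => by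
      simp [chi_of_le hβ.le]

theorem norm_one_sub_chi_le (β : Interval) : ‖1 - chi 𝕜 β‖ ≤ 1 := by
  refine (ContinuousMap.norm_le _ zero_le_one).2 fun x => ?_
  rcases le_or_gt x β with h | h
  · simp [chi_of_le h]
  · simp [chi_of_lt h]

theorem IsMatrixOf.eventually_apply_one_sub_chi {T : C(Interval, 𝕜) →L[𝕜] C(Interval, 𝕜)}
    {A : Interval → Interval → 𝕜} (hA : IsMatrixOf T A) (α : Interval) :
    ∀ᶠ β in 𝓝[<] last, T (1 - chi 𝕜 β) α = A α last := by
  have hc : (Function.support (A α) \ {last}).Countable :=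
    ((hA.summable_row α).of_norm.countable_support).mono sdiff_subset
  have h := (eventually_countable_ball hc).2 fun γ (hγ : γ ∈ Function.support (A α) \ {last}) =>
    eventually_gt_nhdsLT_last (lt_last_iff_ne.2 hγ.2)
  filter_upwards [h, eventually_lt_last] with β hβ hβ'
  refine (hA.hasSum_row _ α).unique ?_
  convert hasSum_single last fun γ hγ => ?_ using 1
  · rw [one_sub_chi_last hβ', mul_one]
  · by_cases h0 : A α γ = 0
    · rw [h0, zero_mul]
    · simp [chi_of_le (hβ γ ⟨h0, hγ⟩).le]

/-- Operators on `C([0, ω₁])` preserve pointwise eventual equality along the filter of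
neighbourhoods of `ω₁`. -/
theorem eventually_apply_eq (T : C(Interval, 𝕜) →L[𝕜] C(Interval, 𝕜))
    {h : Interval → C(Interval, 𝕜)} {g : C(Interval, 𝕜)}
    (hg : ∀ α, ∀ᶠ β in 𝓝[<] last, h β α = g α) (α : Interval) :
    ∀ᶠ β in 𝓝[<] last, T (h β) α = T g α := by
  obtain ⟨A, hA⟩ := exists_isMatrixOf T
  have hc := (hA.summable_row α).of_norm.countable_support
  filter_upwards [(eventually_countable_ball hc).2 fun γ _ => hg γ] with β hβ
  refine (hA.hasSum_row _ α).unique ?_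
  convert hA.hasSum_row g α using 2 with γ
  by_cases h0 : A α γ = 0
  · simp [h0]
  · rw [hβ γ h0]

theorem exists_column_eq (T : C(Interval, 𝕜) →L[𝕜] C(Interval, 𝕜)) {k : Interval → 𝕜}
    (hk : ∀ α, ∀ᶠ β in 𝓝[<] last, T (1 - chi 𝕜 β) α = k α) :
    ∃ (g : C(Interval, 𝕜)) (c : 𝕜), ∀ α, k α = g α + c * if α = last then 1 else 0 := by
  have hC : ∀ α, ‖k α‖ ≤ ‖T‖ := fun α => by
    obtain ⟨β, hβ⟩ := (hk α).exists
    rw [← hβ]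
    refine ((T _).norm_coe_le_norm α).trans ?_
    simpa using T.le_opNorm_of_le (norm_one_sub_chi_le β)
  have hcont : ∀ α < last, ContinuousAt k α := fun α hα => by
    -- One `β` serves all of the countable open set `[0, α]`, where `k` thus agrees with a
    -- continuous function.
    obtain ⟨β, hβ⟩ := ((eventually_countable_ball (countable_Iic_of_lt_last hα)).2
      fun α' _ => hk α').exists
    refine (T (1 - chi 𝕜 β)).continuous.continuousAt.congr ?_
    filter_upwards [(isClopen_Iic α).isOpen.mem_nhds (self_mem_Iic (a := α))] with x hx
    exact hβ x hx
  obtain ⟨a, ha⟩ := exists_eventually_eq_of_continuousAt hC hcont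
  classical
  refine ⟨⟨Function.update k last a, continuous_iff_continuousAt.2 fun α => ?_⟩, k last - a,
    fun α => ?_⟩
  · by_cases h : α = last
    · subst h
      rw [continuousAt_update_same, nhdsNE_last]
      exact tendsto_const_nhds.congr' (ha.mono fun _ h => h.symm)
    · rw [continuousAt_update_of_ne h]
      exact hcont α (lt_last_iff_ne.2 h)
  · by_cases h : α = last
    · subst h; simp
    · simp [h]

theorem eventually_apply_one_sub_chi_sub {T : C(Interval, 𝕜) →L[𝕜] C(Interval, 𝕜)}
    {g : C(Interval, 𝕜)} {c : 𝕜} {k : Interval → 𝕜}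
    (hk : ∀ α, ∀ᶠ β in 𝓝[<] last, T (1 - chi 𝕜 β) α = k α)
    (h : ∀ α, k α = g α + c * if α = last then 1 else 0) (α : Interval) :
    ∀ᶠ β in 𝓝[<] last, (T (1 - chi 𝕜 β) - c • (1 - chi 𝕜 β)) α = g α := by
  filter_upwards [hk α, eventually_one_sub_chi_apply (𝕜 := 𝕜) α] with β h1 h2
  rw [ContinuousMap.sub_apply, h1, h, ContinuousMap.smul_apply, h2]
  simp

/-! ### Operators in the ideal -/

theorem not_identityFactorsThrough_of_mem {T : C(Interval, 𝕜) →L[𝕜] C(Interval, 𝕜)}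
    (hT : T ∈ loyWillisIdeal 𝕜) : ¬ IdentityFactorsThrough T := by
  rintro ⟨R, S, hRS⟩
  obtain ⟨A, hA, hAc⟩ := hT
  obtain ⟨g, c, hg⟩ := exists_column_eq T hA.eventually_apply_one_sub_chi
  obtain ⟨B, hB⟩ := exists_isMatrixOf R
  obtain ⟨u, d, hu⟩ := exists_column_eq R hB.eventually_apply_one_sub_chi
  have hc : c = 0 := by
    have h1 : Tendsto (fun α => A α last) (𝓝[<] last) (𝓝 (g last)) := by
      refine (g.continuous.continuousWithinAt (s := Iio last)).congr' ?_
      filter_upwards [eventually_lt_last] with α hα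
      simp [hg, hα.ne]
    have h2 := tendsto_nhds_unique h1 hAc.continuousWithinAt
    simpa [hg] using h2
  have h1 : ∀ α, ∀ᶠ β in 𝓝[<] last, T (R (1 - chi 𝕜 β)) α = (T u + d • g) α := by
    intro α
    filter_upwards [eventually_apply_eq T (eventually_apply_one_sub_chi_sub
      hB.eventually_apply_one_sub_chi hu) α, hA.eventually_apply_one_sub_chi α] with β h2 h3
    rw [hg, hc, zero_mul, add_zero] at h3
    rw [map_sub, map_smul, ContinuousMap.sub_apply, ContinuousMap.smul_apply, h3,
      sub_eq_iff_eq_add] at h2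
    rw [h2]; simp
  let w := S (T u + d • g)
  have hw : ∀ α, w α = if α = last then 1 else 0 := by
    intro α
    obtain ⟨β, h2, h3⟩ := ((eventually_apply_eq S h1 α).and
      (eventually_one_sub_chi_apply (𝕜 := 𝕜) α)).exists
    rw [← h3]
    refine Eq.trans h2.symm ?_
    exact (DFunLike.congr_fun (DFunLike.congr_fun hRS (1 - chi 𝕜 β)) α).symm
  obtain ⟨α, h2, h3⟩ := ((eventually_eq_last w).and eventually_lt_last).exists
  simp [hw, h3.ne] at h2

/-! ### Operators outside the ideal -/

/-- If the final column of `T` is discontinuous at `ω₁`, then `T` acts as a nonzero multiple of the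
identity on the coordinates in a cofinal set. -/
theorem exists_apply_eq_mul {T : C(Interval, 𝕜) →L[𝕜] C(Interval, 𝕜)}
    (g : C(Interval, 𝕜)) (c : 𝕜)
    (hk : ∀ α, ∀ᶠ β in 𝓝[<] last,
      T (1 - chi 𝕜 β) α = g α + c * if α = last then 1 else 0) :
    ∃ γ < last, ∀ δ₀ < last, ∃ δ < last, δ₀ < δ ∧ ∀ f : C(Interval, 𝕜),
      (∀ β ≤ γ, f β = 0) → f last = 0 → T f δ = c * f δ := by
  obtain ⟨γ, hγ, hγ'⟩ := eventually_nhdsLT_last.1 ((hk last).and (eventually_eq_last g))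
  obtain ⟨γ₀, hγ₀, hγγ₀⟩ := exists_lt_last_of_lt_last hγ
  refine ⟨γ₀, hγ₀, fun δ₀ hδ₀ => ?_⟩
  -- Below `δ`, both stabilisations are complete before `δ`: that of row `α` in `β'`, and that of
  -- the function `T (1 - chi 𝕜 α)` in its argument.
  obtain ⟨δ, hδ, hδ', hcl⟩ := exists_closed_under (Q := fun α β =>
    (∀ β', β ≤ β' → β' < last → T (1 - chi 𝕜 β') α = g α) ∧
    ∀ α', β ≤ α' → α' < last → T (1 - chi 𝕜 α) α' = T (1 - chi 𝕜 α) last) (fun α hα => by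
      have h := hk α
      simp only [hα.ne, if_false, mul_zero, add_zero] at h
      obtain ⟨β, hβ, h⟩ := eventually_nhdsLT_last.1
        (h.and (eventually_eq_last (T (1 - chi 𝕜 α))))
      exact (eventually_gt_nhdsLT_last hβ).mono fun x hx =>
        ⟨fun y hy hy' => (h y (hx.trans_le hy) hy').1, fun y hy hy' => (h y (hx.trans_le hy) hy').2⟩)
    (max_lt hδ₀ hγ₀)
  have hγδ : γ₀ < δ := (le_max_right _ _).trans_lt hδ'
  have hlast : ∀ β, γ₀ ≤ β → β < last → T (1 - chi 𝕜 β) last = g last + c := fun β h1 h2 => by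
    simpa using (hγ' β (hγγ₀.trans_le h1) h2).1
  have hlt : ∀ β < δ, T (1 - chi 𝕜 β) δ = T (1 - chi 𝕜 β) last := fun β hβ => by
    obtain ⟨ε, hε, -, -, h⟩ := hcl β hβ
    exact h δ hε.le hδ
  have hge : ∀ β, δ ≤ β → β < last → T (1 - chi 𝕜 β) δ = g last := fun β h1 h2 => by
    have hmem := mem_closure_of_forall_lt (s := {α | T (1 - chi 𝕜 β) α = g last}) hγδ
      fun α hα => by
        obtain ⟨ε, hε, hαε, -⟩ := hcl (max α γ₀) (max_lt hα hγδ)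
        obtain ⟨ζ, hζ, -, h, -⟩ := hcl ε hε
        refine ⟨ε, hε, (le_max_left _ _).trans_lt hαε, ?_⟩
        exact (h β (hζ.le.trans h1) h2).trans (hγ' ε
          (hγγ₀.trans ((le_max_right _ _).trans_lt hαε)) (hε.trans hδ)).2
    have hclosed : IsClosed {α | T (1 - chi 𝕜 β) α = g last} :=
      isClosed_eq (T _).continuous continuous_const
    exact hclosed.closure_subset (closure_mono inter_subset_left hmem)
  refine ⟨δ, hδ, (le_max_left _ _).trans_lt hδ', ?_⟩
  -- `P` projects onto the functions vanishing on `[0, γ₀]` and at `ω₁`, so the claim need only be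
  -- tested on indicators.
  let P : C(Interval, 𝕜) →L[𝕜] C(Interval, 𝕜) :=
    (ContinuousLinearMap.mul 𝕜 _ (1 - chi 𝕜 γ₀)).comp
      (ContinuousLinearMap.id 𝕜 _ - (eval 𝕜 last).smulRight 1)
  have hP : ∀ f, P f = (1 - chi 𝕜 γ₀) * (f - f last • 1) := fun f => rfl
  have hψ : (eval 𝕜 δ).comp (T.comp P) - c • (eval 𝕜 δ).comp P = 0 := by
    refine eq_zero_of_apply_chi_eq_zero fun β => ?_
    change T (P (chi 𝕜 β)) δ - c * P (chi 𝕜 β) δ = 0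
    rcases (show β ≤ last from β.2).eq_or_lt with rfl | hβ
    · have : P (chi 𝕜 last) = 0 := by
        rw [hP, chi_last]; ext; simp
      simp [this]
    rcases le_or_gt β γ₀ with h | h
    · have : P (chi 𝕜 β) = 0 := by
        rw [hP, chi_of_lt hβ]
        ext x
        rcases le_or_gt x γ₀ with hx | hx
        · simp [chi_of_le hx]
        · simp [chi_of_lt (h.trans_lt hx)]
      simp [this]
    · have : P (chi 𝕜 β) = (1 - chi 𝕜 γ₀) - (1 - chi 𝕜 β) := by
        rw [hP, chi_of_lt hβ]
        ext x
        rcases le_or_gt x γ₀ with hx | hx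
        · simp [chi_of_le hx, chi_of_le (hx.trans h.le)]
        · simp [chi_of_lt hx]
      rw [this, map_sub, ContinuousMap.sub_apply, hlt γ₀ hγδ, hlast γ₀ le_rfl hγ₀]
      rcases lt_or_ge β δ with h' | h'
      · rw [hlt β h', hlast β h.le hβ]
        simp [chi_of_lt h', chi_of_lt hγδ]
      · rw [hge β h' hβ]
        simp [chi_of_le h', chi_of_lt hγδ]
  intro f hf hf'
  have hPf : P f = f := by
    rw [hP, hf']
    ext x
    rcases le_or_gt x γ₀ with hx | hx
    · simp [chi_of_le hx, hf x hx]
    · simp [chi_of_lt hx]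
  have := DFunLike.congr_fun hψ f
  change T (P f) δ - c * P f δ = 0 at this
  rw [hPf] at this
  exact sub_eq_zero.1 this

/-- A closed cofinal subset of `[0, ω₁]` contains a homeomorphic, order-isomorphic copy of
`[0, ω₁]` with the same last point. -/
theorem exists_strictMono_continuous_forall_mem {E : Set Interval} (hE : IsClosed E)
    (hcof : ∀ α < last, ∃ β < last, α < β ∧ β ∈ E) :
    ∃ h : C(Interval, Interval), StrictMono h ∧ h last = last ∧ ∀ ξ, h ξ ∈ E := by
  -- All ordinals above `ω₁` are included to make `D` unbounded, as `enumOrd` requires.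
  let D : Set Ordinal.{0} := {o | ∀ ho : o ≤ ω₁, (⟨o, ho⟩ : Interval) ∈ E}
  have hD : ¬ BddAbove D := by
    rintro ⟨b, hb⟩
    have : Order.succ (max b ω₁) ∈ D := fun ho =>
      absurd ((le_max_right b ω₁).trans_lt (Order.lt_succ _)) ho.not_gt
    exact ((le_max_left b ω₁).trans_lt (Order.lt_succ _)).not_ge (hb this)
  have hnormal : Order.IsNormal (Ordinal.enumOrd D) := by
    refine Ordinal.isNormal_enumOrd (fun t ht hne hb ho => ?_) hD
    have hle : ∀ x ∈ t, x ≤ ω₁ := fun x hx => (le_csSup hb hx).trans ho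
    have hlub : IsLUB (Subtype.val ⁻¹' t : Set Interval) ⟨sSup t, ho⟩ := by
      refine ⟨fun x hx => (le_csSup hb hx : x.1 ≤ sSup t), fun x hx => ?_⟩
      exact (csSup_le hne fun y hy => hx (show (⟨y, hle y hy⟩ : Interval) ∈ _ from hy) :
        sSup t ≤ x.1)
    refine hE.closure_subset_iff.2 (fun x hx => ht hx x.2) (hlub.mem_closure ?_)
    obtain ⟨x, hx⟩ := hne
    exact ⟨⟨x, hle x hx⟩, hx⟩
  have hlt : ∀ o < ω₁, Ordinal.enumOrd D o < ω₁ := by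
    intro o
    induction o using WellFoundedLT.induction with
    | _ o ih =>
    intro ho
    have : Countable (Iio o) := countable_Iio_of_lt_omega_one ho
    have ih' : ∀ η : Iio o, Ordinal.enumOrd D η < ω₁ := fun η => ih η.1 η.2 (lt_trans η.2 ho)
    obtain ⟨β, hβ, hβ'⟩ := exists_lt_last_forall_lt
      (fun η : Iio o => (⟨Ordinal.enumOrd D η, (ih' η).le⟩ : Interval)) ih'
    obtain ⟨x, hx, hβx, hxE⟩ := hcof β hβ
    exact (Ordinal.enumOrd_le_of_forall_lt (s := D) (fun _ => hxE)
      fun η hη => (hβ' ⟨η, hη⟩).trans hβx).trans_lt hx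
  have hω : Ordinal.enumOrd D ω₁ = ω₁ :=
    ((Order.isNormal_iff.1 hnormal).2 _ (Cardinal.isSuccLimit_omega 1) _
      fun b hb => (hlt b hb).le).antisymm (Ordinal.le_enumOrd_self hD)
  have hle : ∀ o ≤ ω₁, Ordinal.enumOrd D o ≤ ω₁ := fun o ho =>
    (hnormal.strictMono.monotone ho).trans_eq hω
  exact ⟨⟨fun ξ => ⟨Ordinal.enumOrd D ξ.1, hle _ ξ.2⟩,
    (hnormal.continuous.comp continuous_subtype_val).subtype_mk _⟩,
    fun ξ η h => hnormal.strictMono h, Subtype.ext hω,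
    fun ξ => Ordinal.enumOrd_mem hD ξ.1 _⟩

theorem exists_continuous_leftInverse {h : C(Interval, Interval)} (hh : StrictMono h)
    (hlast : h last = last) : ∃ r : C(Interval, Interval), ∀ ξ, r (h ξ) = ξ := by
  have hne : ∀ α, {ξ | α ≤ h ξ}.Nonempty := fun α => ⟨last, by rw [mem_ofPred, hlast]; exact α.2⟩
  -- The lower adjoint of `h`; the adjunction `hr` yields continuity.
  let r : Interval → Interval := fun α => wellFounded_lt.min _ (hne α)
  have hr : ∀ α ξ, r α ≤ ξ ↔ α ≤ h ξ := fun α ξ =>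
    ⟨fun h1 => (wellFounded_lt.min_mem _ (hne α)).trans (hh.monotone h1),
      fun h1 => not_lt.1 (wellFounded_lt.not_lt_min (s := {ξ | α ≤ h ξ}) h1)⟩
  have hmono : Monotone r := fun α β hαβ => (hr _ _).2 (hαβ.trans ((hr _ _).1 le_rfl))
  refine ⟨⟨r, OrderTopology.continuous_iff.2 fun b => ⟨?_,
    ((isLowerSet_Iio b).preimage hmono).isOpen⟩⟩, fun ξ => ?_⟩
  · convert isOpen_Ioi (a := h b) using 1
    ext α
    simpa using (hr α b).not
  · refine le_antisymm ((hr _ _).2 le_rfl) (hh.le_iff_le.1 ((hr _ _).1 le_rfl))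

theorem identityFactorsThrough_of_notMem {T : C(Interval, 𝕜) →L[𝕜] C(Interval, 𝕜)}
    (hT : T ∉ loyWillisIdeal 𝕜) : IdentityFactorsThrough T := by
  obtain ⟨A, hA⟩ := exists_isMatrixOf T
  obtain ⟨g, c, hg⟩ := exists_column_eq T hA.eventually_apply_one_sub_chi
  have hc : c ≠ 0 := by
    rintro rfl
    refine hT ⟨A, hA, ?_⟩
    have : (fun α => A α last) = g := funext fun α => by simp [hg]
    rw [this]
    exact g.continuous.continuousAt
  obtain ⟨γ, hγ, hcof⟩ := exists_apply_eq_mul (T := T) g c fun α => by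
    rw [← hg]; exact hA.eventually_apply_one_sub_chi α
  obtain ⟨ε, hε, hγε, hTε⟩ := hcof γ hγ
  let E : Set Interval := (⋂ (f : C(Interval, 𝕜)) (_ : ∀ β ≤ γ, f β = 0) (_ : f last = 0),
    {δ | T f δ = c * f δ}) ∩ (Iic ε)ᶜ
  have hE : IsClosed E := by
    refine IsClosed.inter ?_ (isClopen_Iic ε).compl.isClosed
    refine isClosed_iInter fun f => isClosed_iInter fun _ => isClosed_iInter fun _ => ?_
    exact isClosed_eq (T f).continuous (f.continuous.const_mul c)
  obtain ⟨h, hh, hlast, hhE⟩ := exists_strictMono_continuous_forall_mem hE fun α hα => by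
    obtain ⟨δ, hδ, hαδ, hTδ⟩ := hcof (max α ε) (max_lt hα hε)
    refine ⟨δ, hδ, (le_max_left _ _).trans_lt hαδ, ?_, ?_⟩
    · simpa using hTδ
    · simpa using (le_max_right _ _).trans_lt hαδ
  obtain ⟨r, hr⟩ := exists_continuous_leftInverse hh hlast
  -- `R f` must vanish at `ω₁`, so `f last` is subtracted on `(ε, ω₁]` and stored on `(γ, ε]`; `S`
  -- reads it back at `ε`.
  let R : C(Interval, 𝕜) →L[𝕜] C(Interval, 𝕜) :=
    (ContinuousLinearMap.mul 𝕜 _ (1 - chi 𝕜 ε)).comp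
      (ContinuousMap.compCLM 𝕜 𝕜 r - (eval 𝕜 last).smulRight 1) +
    (eval 𝕜 last).smulRight (chi 𝕜 ε - chi 𝕜 γ)
  let S : C(Interval, 𝕜) →L[𝕜] C(Interval, 𝕜) :=
    c⁻¹ • (ContinuousMap.compCLM 𝕜 𝕜 h + (eval 𝕜 ε).smulRight 1)
  have hR : ∀ f x, R f x = (1 - chi 𝕜 ε x) * (f (r x) - f last * 1) +
    f last * (chi 𝕜 ε x - chi 𝕜 γ x) := fun f x => rfl
  have hS : ∀ f x, S f x = c⁻¹ * (f (h x) + f ε * 1) := fun f x => rfl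
  refine ⟨R, S, ?_⟩
  ext f ξ
  have h1 : ∀ β ≤ γ, R f β = 0 := fun β hβ => by
    simp [hR, chi_of_le hβ, chi_of_le (hβ.trans hγε.le)]
  have h2 : R f last = 0 := by
    have : r last = last := by simpa [hlast] using hr last
    simp [hR, this, chi_of_lt hε, chi_of_lt hγ]
  have h3 : T (R f) (h ξ) = c * R f (h ξ) := by
    have := (hhE ξ).1
    simp only [mem_iInter] at this
    exact this (R f) h1 h2
  have h4 : ε < h ξ := by simpa using (hhE ξ).2
  change f ξ = S (T (R f)) ξ
  rw [hS, h3, hTε _ h1 h2, hR, hR, hr, chi_of_lt h4, chi_of_lt (hγε.trans h4), chi_of_le le_rfl,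
    chi_of_lt hγε]
  field_simp
  ring

end LoyWillis

theorem theorem1p2 {𝕜 : Type*} [RCLike 𝕜]
    (T : C(LoyWillis.Interval, 𝕜) →L[𝕜] C(LoyWillis.Interval, 𝕜)) :
    T ∈ LoyWillis.loyWillisIdeal 𝕜 ↔ ¬ LoyWillis.IdentityFactorsThrough T :=
  ⟨LoyWillis.not_identityFactorsThrough_of_mem, fun h => by
    by_contra hT
    exact h (LoyWillis.identityFactorsThrough_of_notMem hT)⟩
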